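/- \textbf{Theorem 1.} For $n\ge 1$ let $\bar X_n\ge 0$ be random variables such that $\mathbb E[\bar X_n]\to R^*$ as $n\to\infty$ for some $R^*\in(0,\infty)$, such that $(\bar X_n)_{n\ge1}$ satisfies a large deviations principle (with speed $n$) with a good and convex rate function $I:\mathbb R\to[0,\infty]$, and such that $\limsup_{n\to\infty}\mathbb E[\bar X_n^{\gamma n}]^{1/n}<\infty$ for some $\gamma>1$. For $\rho\in\mathbb R$ and a real sequence $\rho_n\to\rho$, let $(T_n^{(k)})_k$ be, in each dimension $n\ge1$, the points of a homogeneous Poisson process in $\mathbb R^n$ of intensity $e^{n\rho_n}$, with marks $X_n^{(k)}$ that are i.i.d. with the law of $\bar X_n$ and independent of the points, all defined on one probability space (with an arbitrary coupling between the dimensions). Let $\mathcal C_n=\bigcup_k B(T_n^{(k)},X_n^{(k)}\sqrt n)$, where $B(t,r)$ is the closed Euclidean ball of center $t$ and radius $r$. Then $$\tau_v:=-\tfrac12\log(2\pi e)+\inf_{R\ge R^*}\bigl(I(R)-\log R\bigr)$$ is a real number, and it is the volume fraction threshold, that is, the unique real number such that the volume fraction $\mathbb P(0\in\mathcal C_n)$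 tends to $0$ whenever $\rho<\tau_v$ and tends to $1$ whenever $\rho>\tau_v$. More precisely, if $\rho<\tau_v$, then $\mathbb P(0\in\mathcal C_n)\to0$ with $$\lim_{n\to\infty}\frac1n\log\mathbb P(0\in\mathcal C_n)=\rho-\tau_v,$$ and if $\rho>\tau_v$, then $\mathbb P(0\in\mathcal C_n)\to1$ with $$\lim_{n\to\infty}\frac1n\log\bigl(-\log\mathbb P(0\notin\mathcal C_n)\bigr)=\rho-\tau_v.$$ -/

import Mathlib

open MeasureTheory ProbabilityTheory Filter Topology Set
open scoped NNReal ENNReal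

/-- `I : ℝ → [0, ∞]` is a good rate function: it is lower semicontinuous and all its level sets
`{x | I x ≤ a}`, for `0 ≤ a < ∞`, are compact. -/
structure IsGoodRateFunction (I : ℝ → ℝ≥0∞) : Prop where
  lowerSemicontinuous : LowerSemicontinuous I
  isCompact_level : ∀ a : ℝ≥0, IsCompact {x : ℝ | I x ≤ (a : ℝ≥0∞)}

/-- The sequence of laws `μ n` satisfies the large deviations principle (with speed `n`) and
rate function `I`. Here `ExpGrowth.expGrowthInf u` and `ExpGrowth.expGrowthSup u` are the lower and
the upper limit, in `[-∞, ∞]`, of `(1 / n) log (u n)`. -/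
structure SatisfiesLDP (μ : ℕ → Measure ℝ) (I : ℝ → ℝ≥0∞) : Prop where
  lower : ∀ G : Set ℝ, IsOpen G →
    -(⨅ x ∈ G, (I x : EReal)) ≤ ExpGrowth.expGrowthInf (fun n => μ n G)
  upper : ∀ F : Set ℝ, IsClosed F →
    ExpGrowth.expGrowthSup (fun n => μ n F) ≤ -(⨅ x ∈ F, (I x : EReal))

/-- The standing assumptions on the laws `μ n`, `n ≥ 1`, of the normalized radii: they are carried
by `[0, ∞)`, their means converge to `Rstar ∈ (0, ∞)`, they satisfy a large deviations principle
with good convex rate function `I`, and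
`limsup (E[X_n ^ (γ n)]) ^ (1 / n) < ∞` for some `γ > 1`. -/
structure RadiusAssumptions (μ : ℕ → Measure ℝ) (I : ℝ → ℝ≥0∞) (Rstar : ℝ) : Prop where
  isProbabilityMeasure : ∀ n : ℕ, 1 ≤ n → IsProbabilityMeasure (μ n)
  nonneg : ∀ n : ℕ, 1 ≤ n → ∀ᵐ x ∂(μ n), 0 ≤ x
  Rstar_pos : 0 < Rstar
  tendsto_mean : Tendsto (fun n => ∫⁻ x, ENNReal.ofReal x ∂(μ n)) atTop (𝓝 (ENNReal.ofReal Rstar))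
  goodRate : IsGoodRateFunction I
  convex : ConvexOn ℝ≥0 univ I
  ldp : SatisfiesLDP μ I
  moment : ∃ γ : ℝ, 1 < γ ∧
    limsup (fun n : ℕ => (∫⁻ x, ENNReal.ofReal x ^ (γ * (n : ℝ)) ∂(μ n)) ^ (1 / (n : ℝ))) atTop < ⊤

/-- The random counting measure `∑ₖ δ_{Tₖ}` of the point process with points `T k`, evaluated at
the outcome `ω`. -/
noncomputable def countingMeasure {Ω : Type*} {n : ℕ} (T : ℕ → Ω → EuclideanSpace ℝ (Fin n))
    (ω : Ω) : Measure (EuclideanSpace ℝ (Fin n)) :=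
  Measure.sum fun k => Measure.dirac (T k ω)

/-- The points `T k` (in some measurable enumeration) form a homogeneous Poisson point process of
intensity `lam` on `ℝⁿ`: the number of points in a bounded Borel set `A` is Poisson with mean
`lam * vol A`, and the numbers of points in finitely many pairwise disjoint bounded Borel sets are
independent. (For `n ≥ 1` and `lam > 0` there are almost surely infinitely many points, so that
they can be indexed by `ℕ`.) -/
structure IsPoissonProcess {Ω : Type*} [MeasurableSpace Ω] (P : Measure Ω) {n : ℕ} (lam : ℝ≥0)
    (T : ℕ → Ω → EuclideanSpace ℝ (Fin n)) : Prop where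
  measurable : ∀ k, Measurable (T k)
  law_count : ∀ A : Set (EuclideanSpace ℝ (Fin n)), MeasurableSet A → Bornology.IsBounded A →
    P.map (fun ω => countingMeasure T ω A) =
      (poissonMeasure (lam * (volume A).toNNReal)).map (fun j : ℕ => (j : ℝ≥0∞))
  indep_count : ∀ (m : ℕ) (A : Fin m → Set (EuclideanSpace ℝ (Fin n))),
    (∀ i, MeasurableSet (A i)) → (∀ i, Bornology.IsBounded (A i)) →
    (∀ i j, i ≠ j → Disjoint (A i) (A j)) →
    iIndepFun (fun i ω => countingMeasure T ω (A i)) P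

/-- The points `T k` form a homogeneous Poisson point process of intensity `lam` on `ℝⁿ`, and the
marks `X k` are independent and identically distributed with law `μ`, and independent of the
points. -/
structure IsMarkedPoissonProcess {Ω : Type*} [MeasurableSpace Ω] (P : Measure Ω) {n : ℕ}
    (lam : ℝ≥0) (μ : Measure ℝ) (T : ℕ → Ω → EuclideanSpace ℝ (Fin n)) (X : ℕ → Ω → ℝ) :
    Prop where
  poisson : IsPoissonProcess P lam T
  measurable_mark : ∀ k, Measurable (X k)
  law_mark : ∀ k, P.map (X k) = μ
  indep_mark : iIndepFun X P
  indep_points_marks : IndepFun (fun ω k => T k ω) (fun ω k => X k ω) P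

/-- The Boolean model `⋃ₖ B(Tₖ, Xₖ √n)` in `ℝⁿ`, with closed balls, at the outcome `ω`. -/
def booleanModel {Ω : Type*} {n : ℕ} (T : ℕ → Ω → EuclideanSpace ℝ (Fin n)) (X : ℕ → Ω → ℝ)
    (ω : Ω) : Set (EuclideanSpace ℝ (Fin n)) :=
  ⋃ k, Metric.closedBall (T k ω) (X k ω * Real.sqrt n)

/-- The probability that the origin is covered by the Boolean model (the volume fraction). -/
noncomputable def coverProb {Ω : Type*} [MeasurableSpace Ω] (P : Measure Ω) {n : ℕ}
    (T : ℕ → Ω → EuclideanSpace ℝ (Fin n)) (X : ℕ → Ω → ℝ) : ℝ≥0∞ :=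
  P {ω | 0 ∈ booleanModel T X ω}

/-- The probability that the origin is not covered by the Boolean model. -/
noncomputable def uncoverProb {Ω : Type*} [MeasurableSpace Ω] (P : Measure Ω) {n : ℕ}
    (T : ℕ → Ω → EuclideanSpace ℝ (Fin n)) (X : ℕ → Ω → ℝ) : ℝ≥0∞ :=
  P {ω | 0 ∉ booleanModel T X ω}

/-- In every dimension `n ≥ 1`, `T n` is a Poisson process of intensity `exp (n ρₙ)` with i.i.d.
marks `X n` of law `μ n`, independent of the points, and `ρₙ → ρ`; all dimensions live on one
probability space. -/
structure IsShannonRegime {Ω : Type*} [MeasurableSpace Ω] (P : Measure Ω) (μ : ℕ → Measure ℝ)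
    (ρ : ℝ) (ρs : ℕ → ℝ) (T : (n : ℕ) → ℕ → Ω → EuclideanSpace ℝ (Fin n))
    (X : ℕ → ℕ → Ω → ℝ) : Prop where
  tendsto_rho : Tendsto ρs atTop (𝓝 ρ)
  marked : ∀ n : ℕ, 1 ≤ n →
    IsMarkedPoissonProcess P (Real.toNNReal (Real.exp ((n : ℝ) * ρs n))) (μ n) (T n) (X n)

/-- `p ρ n` being the volume fraction in dimension `n` for the asymptotic normalized logarithmic
intensity `ρ`, the number `τ` is a volume fraction threshold if the volume fraction tends to `0`
for `ρ < τ` and to `1` for `ρ > τ`. -/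
def IsVolumeFractionThreshold (p : ℝ → ℕ → ℝ≥0∞) (τ : ℝ) : Prop :=
  ∀ ρ : ℝ, (ρ < τ → Tendsto (p ρ) atTop (𝓝 0)) ∧ (τ < ρ → Tendsto (p ρ) atTop (𝓝 1))

/-! Given the points, the origin is missed with probability equal to a product over the points;
averaging over the points with the Laplace functional and applying Tonelli gives `P(0 ∉ C_n) =
exp(-m_n)`, where `m_n = e^{nρ_n} vol(B(0, √n)) E[X_n^n]` is the mean number of balls covering the
origin (`IsMarkedPoissonProcess.uncoverProb_eq`). Everything thus reduces to the exponential rate of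
`m_n`.

The ball volume has rate `½ log(2πe)` (`tendsto_log_ballVolume_div`). The moments `E[X_n^n]` have
rate `sup_{R ≥ R*} (log R - I(R))` (`RadiusAssumptions.exists_moment_rate`), an instance of
Varadhan's lemma: the lower bound comes from half-lines just below `R`, the upper bound from
finitely many geometric slices, with the `γn`-th moments controlling the tail. Radii below `R*` may
be discarded because they contribute at most `log R*`, which is the value at `R = R*` since `I(R*) =
0` (`RadiusAssumptions.rate_Rstar`).

Hence `m_n` has rate `ρ - τ_v`. If this is negative, `1 - e^{-m_n}` is comparable to `m_n`; if it is
positive, `e^{-m_n}` tends to `0`, and `-log P(0 ∉ C_n)` is `m_n` itself. -/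

/-! ### The exponential on `[0, ∞]` and the Poisson generating function. -/

/-- The function `x ↦ e⁻ˣ` on `[0, ∞]`. -/
noncomputable def expNeg (x : ℝ≥0∞) : ℝ≥0∞ := EReal.exp (-(x : EReal))

@[simp] lemma expNeg_zero : expNeg 0 = 1 := by simp [expNeg]

@[simp] lemma expNeg_top : expNeg ⊤ = 0 := by simp [expNeg]

lemma expNeg_add (x y : ℝ≥0∞) : expNeg (x + y) = expNeg x * expNeg y := by
  rw [expNeg, expNeg, expNeg, ← EReal.exp_add, EReal.coe_ennreal_add,
    EReal.neg_add (.inl (EReal.coe_ennreal_ne_bot _)) (.inr (EReal.coe_ennreal_ne_bot _)),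
    sub_eq_add_neg]

lemma expNeg_sum {ι : Type*} (s : Finset ι) (f : ι → ℝ≥0∞) :
    expNeg (∑ i ∈ s, f i) = ∏ i ∈ s, expNeg (f i) := by
  classical
  induction s using Finset.induction_on with
  | empty => simp
  | insert i s hi ih => rw [Finset.sum_insert hi, Finset.prod_insert hi, expNeg_add, ih]

lemma expNeg_le_one (x : ℝ≥0∞) : expNeg x ≤ 1 := by
  rw [expNeg, EReal.exp_le_one_iff, EReal.neg_le_zero]
  exact EReal.coe_ennreal_nonneg x

lemma continuous_expNeg : Continuous expNeg :=
  ENNReal.continuous_exp.comp (continuous_neg.comp continuous_coe_ennreal_ereal)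

lemma expNeg_antitone : Antitone expNeg := fun x y h => by
  rw [expNeg, expNeg, EReal.exp_le_exp_iff, EReal.neg_le_neg_iff]
  exact_mod_cast h

lemma expNeg_ofReal {x : ℝ} (hx : 0 ≤ x) :
    expNeg (ENNReal.ofReal x) = ENNReal.ofReal (Real.exp (-x)) := by
  rw [expNeg, EReal.coe_ennreal_ofReal, max_eq_left hx, ← EReal.coe_neg, EReal.exp_coe]

lemma log_expNeg (x : ℝ≥0∞) : ENNReal.log (expNeg x) = -(x : EReal) := by
  rw [expNeg, EReal.log_exp]

lemma expNeg_toENNReal_neg_log {p : ℝ≥0∞} (hp : p ≤ 1) :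
    expNeg (-ENNReal.log p).toENNReal = p := by
  rw [expNeg, EReal.coe_toENNReal, neg_neg, ENNReal.exp_log]
  rw [EReal.neg_nonneg]
  simpa using hp

lemma expNeg_mul_natCast (c : ℝ≥0∞) (j : ℕ) : expNeg (c * j) = expNeg c ^ j := by
  induction j with
  | zero => simp
  | succ j ih => rw [pow_succ, ← ih, ← expNeg_add]; push_cast; ring_nf

/-- Probability generating function of the Poisson law, summed from the exponential series. -/
lemma lintegral_poissonMeasure_pow (r : ℝ≥0) {q : ℝ≥0∞} (hq : q ≤ 1) :
    ∫⁻ j : ℕ, q ^ j ∂(poissonMeasure r) = expNeg (r * (1 - q)) := by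
  obtain ⟨x, hx0, hx1, rfl⟩ : ∃ x : ℝ, 0 ≤ x ∧ x ≤ 1 ∧ q = ENNReal.ofReal x := by
    have hq' : q ≠ ⊤ := (hq.trans_lt ENNReal.one_lt_top).ne
    refine ⟨q.toReal, ENNReal.toReal_nonneg, ?_, (ENNReal.ofReal_toReal hq').symm⟩
    exact ENNReal.toReal_le_of_le_ofReal zero_le_one (by simpa using hq)
  have hsum := (NormedSpace.expSeries_div_hasSum_exp ((r : ℝ) * x)).mul_left (Real.exp (-r))
  rw [← Real.exp_eq_exp_ℝ, ← Real.exp_add] at hsum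
  have h1 : (r : ℝ≥0∞) * (1 - ENNReal.ofReal x) = ENNReal.ofReal (r * (1 - x)) := by
    rw [ENNReal.ofReal_mul r.coe_nonneg, ENNReal.ofReal_sub _ hx0]; simp
  rw [h1, expNeg_ofReal (mul_nonneg r.coe_nonneg (by linarith)), poissonMeasure, lintegral_sum_measure]
  simp_rw [lintegral_smul_measure, lintegral_dirac, smul_eq_mul]
  have h2 : -((r : ℝ) * (1 - x)) = -r + r * x := by ring
  rw [h2, ← hsum.tsum_eq, ENNReal.ofReal_tsum_of_nonneg (fun n => by positivity) hsum.summable]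
  congr with j
  rw [← ENNReal.ofReal_pow hx0, ← ENNReal.ofReal_mul (by positivity)]
  congr 1
  rw [mul_pow]; ring

/-! ### The Laplace functional of a Poisson process. -/

lemma lintegral_countingMeasure {Ω : Type*} {n : ℕ} (T : ℕ → Ω → EuclideanSpace ℝ (Fin n)) (ω : Ω)
    (f : EuclideanSpace ℝ (Fin n) → ℝ≥0∞) :
    ∫⁻ t, f t ∂(countingMeasure T ω) = ∑' k, f (T k ω) := by
  rw [countingMeasure, lintegral_sum_measure]
  simp

section Laplace

variable {Ω : Type*} [MeasurableSpace Ω] {P : Measure Ω} {n : ℕ} {lam : ℝ≥0}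
  {T : ℕ → Ω → EuclideanSpace ℝ (Fin n)}

lemma IsPoissonProcess.measurable_lintegral (h : IsPoissonProcess P lam T)
    {f : EuclideanSpace ℝ (Fin n) → ℝ≥0∞} (hf : Measurable f) :
    Measurable fun ω => ∫⁻ t, f t ∂(countingMeasure T ω) := by
  simp_rw [lintegral_countingMeasure]
  exact Measurable.tsum fun k => hf.comp (h.measurable k)

lemma IsPoissonProcess.measurable_count (h : IsPoissonProcess P lam T)
    {A : Set (EuclideanSpace ℝ (Fin n))} (hA : MeasurableSet A) :
    Measurable fun ω => countingMeasure T ω A := by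
  have := h.measurable_lintegral (f := A.indicator 1) (measurable_one.indicator hA)
  simpa [lintegral_indicator_one hA] using this

lemma IsPoissonProcess.lintegral_expNeg_count (h : IsPoissonProcess P lam T)
    {A : Set (EuclideanSpace ℝ (Fin n))} (hA : MeasurableSet A) (hb : Bornology.IsBounded A)
    (c : ℝ≥0∞) :
    ∫⁻ ω, expNeg (c * countingMeasure T ω A) ∂P = expNeg (lam * ((1 - expNeg c) * volume A)) := by
  have hm : Measurable fun x : ℝ≥0∞ => expNeg (c * x) :=
    continuous_expNeg.measurable.comp (measurable_const.mul measurable_id)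
  have h1 := lintegral_map (μ := P) hm (h.measurable_count hA)
  rw [← h1, h.law_count A hA hb,
    lintegral_map hm (measurable_of_countable _)]
  simp only [expNeg_mul_natCast]
  rw [lintegral_poissonMeasure_pow _ (expNeg_le_one c), ENNReal.coe_mul,
    ENNReal.coe_toNNReal hb.measure_lt_top.ne]
  congr 1; ring

/-- The level sets of `s` inside `B` are disjoint and bounded, so their counts are independent
Poisson variables and the expectation factors. The restriction to `B` is needed because counts are
prescribed only on bounded sets. -/
lemma IsPoissonProcess.lintegral_expNeg_simpleFunc (h : IsPoissonProcess P lam T)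
    {B : Set (EuclideanSpace ℝ (Fin n))} (hB : MeasurableSet B) (hb : Bornology.IsBounded B)
    (s : SimpleFunc (EuclideanSpace ℝ (Fin n)) ℝ≥0∞) :
    ∫⁻ ω, expNeg (∫⁻ t in B, s t ∂(countingMeasure T ω)) ∂P =
      expNeg (lam * ∫⁻ t in B, (1 - expNeg (s t))) := by
  let e := s.range.equivFin
  let A : Fin s.range.card → Set (EuclideanSpace ℝ (Fin n)) :=
    fun i => s ⁻¹' {((e.symm i : s.range) : ℝ≥0∞)} ∩ B
  have hA : ∀ i, MeasurableSet (A i) := fun i => (s.measurableSet_preimage _).inter hB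
  have hAb : ∀ i, Bornology.IsBounded (A i) := fun i => hb.subset inter_subset_right
  have hAd : ∀ i j, i ≠ j → Disjoint (A i) (A j) := fun i j hij => by
    rw [Set.disjoint_left]
    rintro x ⟨hx, -⟩ ⟨hx', -⟩
    exact hij (e.symm.injective (Subtype.ext (hx.symm.trans hx')))
  have hsum : ∀ F : ℝ≥0∞ → ℝ≥0∞, ∑ x ∈ s.range, F x = ∑ i, F (e.symm i : s.range) := fun F => by
    rw [← Finset.sum_coe_sort, ← Equiv.sum_comp e.symm]
  have h1 : ∀ ω, ∫⁻ t in B, s t ∂(countingMeasure T ω) =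
      ∑ i, ((e.symm i : s.range) : ℝ≥0∞) * countingMeasure T ω (A i) := fun ω => by
    rw [SimpleFunc.lintegral_eq_lintegral, SimpleFunc.lintegral, hsum]
    simp_rw [Measure.restrict_apply (s.measurableSet_preimage _)]
    rfl
  have h2 : ∫⁻ t in B, (1 - expNeg (s t)) =
      ∑ i, (1 - expNeg ((e.symm i : s.range) : ℝ≥0∞)) * volume (A i) := by
    have := SimpleFunc.lintegral_eq_lintegral (s.map fun x => 1 - expNeg x) (volume.restrict B)
    rw [SimpleFunc.map_lintegral] at this
    simp only [SimpleFunc.map_apply] at this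
    rw [this, hsum]
    simp_rw [Measure.restrict_apply (s.measurableSet_preimage _)]
    rfl
  simp_rw [h1, h2, expNeg_sum, Finset.mul_sum, expNeg_sum]
  have hm : ∀ c : ℝ≥0∞, Measurable fun x : ℝ≥0∞ => expNeg (c * x) := fun c =>
    continuous_expNeg.measurable.comp (measurable_const.mul measurable_id)
  rw [lintegral_prod_eq_prod_lintegral_of_indepFun Finset.univ
    (fun i ω => expNeg (((e.symm i : s.range) : ℝ≥0∞) * countingMeasure T ω (A i)))]
  · exact Finset.prod_congr rfl fun i _ => h.lintegral_expNeg_count (hA i) (hAb i) _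
  · exact (h.indep_count _ A hA hAb hAd).comp _ fun i => hm _
  · exact fun i => (hm _).comp (h.measurable_count (hA i))

/-- The Laplace functional of a homogeneous Poisson process. -/
lemma IsPoissonProcess.lintegral_expNeg [IsProbabilityMeasure P] (h : IsPoissonProcess P lam T)
    {f : EuclideanSpace ℝ (Fin n) → ℝ≥0∞} (hf : Measurable f) :
    ∫⁻ ω, expNeg (∫⁻ t, f t ∂(countingMeasure T ω)) ∂P =
      expNeg (lam * ∫⁻ t, (1 - expNeg (f t))) := by
  -- Truncating the simple approximations of `f` to growing balls keeps them monotone and makes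
  -- their supports bounded. The left side then passes to the limit by dominated convergence, the
  -- right side by monotone convergence.
  let B : ℕ → Set (EuclideanSpace ℝ (Fin n)) := fun m => Metric.ball 0 m
  let g : ℕ → EuclideanSpace ℝ (Fin n) → ℝ≥0∞ :=
    fun m => (B m).indicator (SimpleFunc.eapprox f m)
  have hB : ∀ m, MeasurableSet (B m) := fun m => Metric.isOpen_ball.measurableSet
  have hgm : ∀ m, Measurable (g m) := fun m =>
    (SimpleFunc.measurable _).indicator (hB m)
  have hmono : Monotone g := fun m m' hmm t => by
    have : B m ⊆ B m' := Metric.ball_subset_ball (by exact_mod_cast hmm)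
    refine (Set.indicator_le_indicator_of_subset this (fun _ => zero_le) t).trans ?_
    exact Set.indicator_le_indicator (SimpleFunc.monotone_eapprox f hmm t)
  have hlim : ∀ t, Tendsto (fun m => g m t) atTop (𝓝 (f t)) := fun t => by
    have h1 : Tendsto (fun m => (SimpleFunc.eapprox f m) t) atTop (𝓝 (f t)) :=
      SimpleFunc.tendsto_eapprox hf t
    refine h1.congr' ?_
    obtain ⟨m₀, hm₀⟩ := exists_nat_gt ‖t‖
    filter_upwards [eventually_ge_atTop m₀] with m hm
    have : t ∈ B m := by
      simp only [B, Metric.mem_ball, dist_zero_right]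
      exact hm₀.trans_le (by exact_mod_cast hm)
    simp [g, this]
  have hlint : ∀ ν : Measure (EuclideanSpace ℝ (Fin n)), Tendsto (fun m => ∫⁻ t, g m t ∂ν) atTop
      (𝓝 (∫⁻ t, f t ∂ν)) := fun ν =>
    lintegral_tendsto_of_tendsto_of_monotone (fun m => (hgm m).aemeasurable)
      (ae_of_all _ fun t m m' hmm => hmono hmm t) (ae_of_all _ hlim)
  have hkey : ∀ m, ∫⁻ ω, expNeg (∫⁻ t, g m t ∂(countingMeasure T ω)) ∂P =
      expNeg (lam * ∫⁻ t, (1 - expNeg (g m t))) := fun m => by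
    have h1 := h.lintegral_expNeg_simpleFunc (hB m) Metric.isBounded_ball (SimpleFunc.eapprox f m)
    simp_rw [← lintegral_indicator (hB m)] at h1
    refine h1.trans ?_
    congr 2
    refine lintegral_congr fun t => ?_
    by_cases ht : t ∈ B m <;> simp [g, ht]
  have hL : Tendsto (fun m => ∫⁻ ω, expNeg (∫⁻ t, g m t ∂(countingMeasure T ω)) ∂P) atTop
      (𝓝 (∫⁻ ω, expNeg (∫⁻ t, f t ∂(countingMeasure T ω)) ∂P)) := by
    refine tendsto_lintegral_of_dominated_convergence (fun _ => 1)
      (fun m => continuous_expNeg.measurable.comp (h.measurable_lintegral (hgm m)))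
      (fun m => ae_of_all _ fun ω => expNeg_le_one _) (by simp) (ae_of_all _ fun ω => ?_)
    exact (continuous_expNeg.tendsto _).comp (hlint _)
  have hR : Tendsto (fun m => ∫⁻ t, (1 - expNeg (g m t))) atTop
      (𝓝 (∫⁻ t, (1 - expNeg (f t)))) := by
    refine lintegral_tendsto_of_tendsto_of_monotone
      (fun m => (measurable_const.sub (continuous_expNeg.measurable.comp (hgm m))).aemeasurable)
      (ae_of_all _ fun t m m' hmm => tsub_le_tsub_left (expNeg_antitone (hmono hmm t)) _)
      (ae_of_all _ fun t => ?_)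
    exact ENNReal.Tendsto.sub tendsto_const_nhds ((continuous_expNeg.tendsto _).comp (hlim t))
      (.inl ENNReal.one_ne_top)
  have hR' : Tendsto (fun m => expNeg (lam * ∫⁻ t, (1 - expNeg (g m t)))) atTop
      (𝓝 (expNeg (lam * ∫⁻ t, (1 - expNeg (f t))))) :=
    (continuous_expNeg.tendsto _).comp
      (ENNReal.Tendsto.const_mul hR (.inr ENNReal.coe_ne_top))
  simp_rw [hkey] at hL
  exact tendsto_nhds_unique hL hR'

end Laplace

/-! ### The probability that the origin is not covered. -/

lemma zero_notMem_booleanModel {Ω : Type*} {n : ℕ} (T : ℕ → Ω → EuclideanSpace ℝ (Fin n)) (X : ℕ → Ω → ℝ) (ω : Ω) :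
    0 ∉ booleanModel T X ω ↔ ∀ k, X k ω * Real.sqrt n < ‖T k ω‖ := by
  simp [booleanModel]

section Marked

variable {Ω : Type*} [MeasurableSpace Ω] {P : Measure Ω} [IsProbabilityMeasure P] {n : ℕ}
  {lam : ℝ≥0} {μ : Measure ℝ} {T : ℕ → Ω → EuclideanSpace ℝ (Fin n)} {X : ℕ → Ω → ℝ}

/-- For i.i.d. marks, the probability that no ball with deterministic center `t k` covers the
origin. -/
lemma measure_forall_mark_lt (hX : ∀ k, Measurable (X k)) (hlaw : ∀ k, P.map (X k) = μ)
    (hind : iIndepFun X P) {f : EuclideanSpace ℝ (Fin n) → ℝ≥0∞}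
    (hf : ∀ t, expNeg (f t) = μ {x | x * Real.sqrt n < ‖t‖})
    (t : ℕ → EuclideanSpace ℝ (Fin n)) :
    P {ω | ∀ k, X k ω * Real.sqrt n < ‖t k‖} = expNeg (∑' k, f (t k)) := by
  let A : ℕ → Set ℝ := fun k => {x | x * Real.sqrt n < ‖t k‖}
  have hA : ∀ k, MeasurableSet (A k) := fun k =>
    measurableSet_lt (measurable_id.mul_const _) measurable_const
  let D : ℕ → Set Ω := fun m => ⋂ k ∈ Finset.range m, X k ⁻¹' A k
  have hD : ∀ m, MeasurableSet (D m) := fun m =>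
    Finset.measurableSet_biInter _ fun k _ => hX k (hA k)
  have hDanti : Antitone D := fun m m' hmm =>
    biInter_subset_biInter_left (fun k hk => by
      simp only [Finset.mem_coe, Finset.mem_range] at hk ⊢; omega)
  have hDP : ∀ m, P (D m) = expNeg (∑ k ∈ Finset.range m, f (t k)) := fun m => by
    rw [hind.measure_inter_preimage_eq_mul _ fun k _ => hA k, expNeg_sum]
    refine Finset.prod_congr rfl fun k _ => ?_
    rw [hf, ← hlaw k, Measure.map_apply (hX k) (hA k)]
  have hset : {ω | ∀ k, X k ω * Real.sqrt n < ‖t k‖} = ⋂ m, D m := by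
    ext ω
    simp only [D, A, mem_ofPred_eq, mem_iInter, Finset.mem_range, mem_preimage]
    exact ⟨fun h _ k _ => h k, fun h k => h (k + 1) k (Nat.lt_succ_self k)⟩
  have h1 : Tendsto (fun m => P (D m)) atTop (𝓝 (P (⋂ m, D m))) :=
    tendsto_measure_iInter_atTop (fun m => (hD m).nullMeasurableSet) hDanti
      ⟨0, measure_ne_top _ _⟩
  have h2 : Tendsto (fun m => P (D m)) atTop (𝓝 (expNeg (∑' k, f (t k)))) := by
    simp_rw [hDP]
    exact (continuous_expNeg.tendsto _).comp (ENNReal.tendsto_nat_tsum _)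
  rw [hset]
  exact tendsto_nhds_unique h1 h2

/-- The uncovered probability of the Boolean model. -/
lemma IsMarkedPoissonProcess.uncoverProb_eq (h : IsMarkedPoissonProcess P lam μ T X) :
    uncoverProb P T X =
      expNeg (lam * ∫⁻ x, volume (Metric.closedBall (0 : EuclideanSpace ℝ (Fin n))
        (x * Real.sqrt n)) ∂μ) := by
  have hμ : IsProbabilityMeasure μ := by
    rw [← h.law_mark 0]; exact Measure.isProbabilityMeasure_map (h.measurable_mark 0).aemeasurable
  let g : EuclideanSpace ℝ (Fin n) → ℝ≥0∞ := fun t => μ {x | x * Real.sqrt n < ‖t‖}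
  have hS : MeasurableSet {p : EuclideanSpace ℝ (Fin n) × ℝ | ‖p.1‖ ≤ p.2 * Real.sqrt n} :=
    measurableSet_le (measurable_fst.norm) (measurable_snd.mul_const _)
  have hgm : Measurable g := by
    have := measurable_measure_prodMk_left (ν := μ) hS.compl
    simpa [g, compl_ofPred] using this
  -- Minus the logarithm of the probability that a ball centered at `t` misses the origin. It is
  -- infinite where that probability vanishes, which is why the exponential is taken on `[0, ∞]`.
  let f : EuclideanSpace ℝ (Fin n) → ℝ≥0∞ := fun t => (-ENNReal.log (g t)).toENNReal
  have hfg : ∀ t, expNeg (f t) = g t := fun t => expNeg_toENNReal_neg_log prob_le_one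
  have hfm : Measurable f :=
    (measurable_ereal_toENNReal).comp (ENNReal.measurable_log.comp hgm).neg
  have hTm : Measurable fun ω k => T k ω := measurable_pi_lambda _ h.poisson.measurable
  have hXm : Measurable fun ω k => X k ω := measurable_pi_lambda _ h.measurable_mark
  let S : Set ((ℕ → EuclideanSpace ℝ (Fin n)) × (ℕ → ℝ)) :=
    {p | ∀ k, p.2 k * Real.sqrt n < ‖p.1 k‖}
  have hSm : MeasurableSet S := by
    have : S = ⋂ k, {p | p.2 k * Real.sqrt n < ‖p.1 k‖} := by ext; simp [S]
    rw [this]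
    exact MeasurableSet.iInter fun k => measurableSet_lt
      (((measurable_pi_apply k).comp measurable_snd).mul_const _)
      ((measurable_pi_apply k).comp measurable_fst).norm
  have hPX : IsProbabilityMeasure (P.map fun ω k => X k ω) :=
    Measure.isProbabilityMeasure_map hXm.aemeasurable
  have h1 : uncoverProb P T X = P.map (fun ω => ((fun k => T k ω), fun k => X k ω)) S := by
    rw [Measure.map_apply (hTm.prodMk hXm) hSm, uncoverProb]
    congr 1
    ext ω
    exact zero_notMem_booleanModel T X ω
  have h2 : ∀ t : ℕ → EuclideanSpace ℝ (Fin n),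
      (P.map fun ω k => X k ω) (Prod.mk t ⁻¹' S) = expNeg (∑' k, f (t k)) := fun t => by
    rw [Measure.map_apply hXm (measurable_prodMk_left hSm)]
    exact measure_forall_mark_lt h.measurable_mark h.law_mark h.indep_mark hfg t
  rw [h1, h.indep_points_marks.map_prod_eq_prod_map_map hTm.aemeasurable hXm.aemeasurable,
    Measure.prod_apply hSm]
  simp_rw [h2]
  rw [lintegral_map _ hTm]
  swap
  · exact continuous_expNeg.measurable.comp
      (Measurable.tsum fun k => hfm.comp (measurable_pi_apply k))
  simp_rw [← lintegral_countingMeasure]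
  rw [h.poisson.lintegral_expNeg hfm]
  congr 2
  have h3 : ∀ t, 1 - expNeg (f t) = μ (Prod.mk t ⁻¹'
      {p : EuclideanSpace ℝ (Fin n) × ℝ | ‖p.1‖ ≤ p.2 * Real.sqrt n}) := fun t => by
    have hm : MeasurableSet {x : ℝ | x * Real.sqrt n < ‖t‖} :=
      measurableSet_lt (measurable_id.mul_const _) measurable_const
    rw [hfg]
    change 1 - μ {x : ℝ | x * Real.sqrt n < ‖t‖} = _
    rw [← prob_compl_eq_one_sub hm]
    congr 1
    ext x
    simp
  simp_rw [h3]
  -- Tonelli: the integral over centers of the covering probability is the mean volume of the ball.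
  rw [← Measure.prod_apply hS, Measure.prod_apply_symm hS]
  refine lintegral_congr fun x => ?_
  congr 1
  ext t
  simp

lemma IsMarkedPoissonProcess.coverProb_eq (h : IsMarkedPoissonProcess P lam μ T X) :
    coverProb P T X = 1 - uncoverProb P T X := by
  have hm : MeasurableSet {ω | 0 ∉ booleanModel T X ω} := by
    have : {ω | 0 ∉ booleanModel T X ω} = ⋂ k, {ω | X k ω * Real.sqrt n < ‖T k ω‖} := by
      ext ω; simp only [mem_ofPred_eq, zero_notMem_booleanModel, mem_iInter]
    rw [this]
    exact MeasurableSet.iInter fun k => measurableSet_lt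
      ((h.measurable_mark k).mul_const _) (h.poisson.measurable k).norm
  rw [uncoverProb, ← prob_compl_eq_one_sub hm, coverProb]
  congr 1
  ext ω
  simp

end Marked

/-! ### Exponential rate of the ball volume. -/

/-- The volume of the Euclidean ball of radius `√n` in dimension `n`. -/
noncomputable def ballVolume (n : ℕ) : ℝ :=
  Real.sqrt n ^ n * (Real.sqrt Real.pi ^ n / Real.Gamma (n / 2 + 1))

lemma ballVolume_pos {n : ℕ} (hn : 1 ≤ n) : 0 < ballVolume n := by
  have h1 : (0 : ℝ) < n := by exact_mod_cast hn
  have h2 : 0 < Real.Gamma ((n : ℝ) / 2 + 1) := Real.Gamma_pos_of_pos (by positivity)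
  rw [ballVolume]
  positivity

lemma volume_closedBall_mul_sqrt {n : ℕ} (hn : 1 ≤ n) (x : ℝ) :
    volume (Metric.closedBall (0 : EuclideanSpace ℝ (Fin n)) (x * Real.sqrt n)) =
      ENNReal.ofReal (ballVolume n) * ENNReal.ofReal x ^ n := by
  have : Nonempty (Fin n) := ⟨⟨0, hn⟩⟩
  rw [EuclideanSpace.volume_closedBall, Fintype.card_fin, ENNReal.ofReal_mul' (Real.sqrt_nonneg _),
    mul_pow, ballVolume, ENNReal.ofReal_mul (by positivity), ENNReal.ofReal_pow (by positivity)]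
  ring

/-- Legendre duplication gives the product of `Γ((n+1)/2)` and `Γ(n/2+1)` in terms of `n!`. The two
factors differ by a ratio between `1` and `(n+1)/2`, since `Γ` increases on `[2, ∞)`; `n ≥ 3` puts
the arguments there. -/
lemma log_Gamma_half_bounds {n : ℕ} (hn : 3 ≤ n) :
    (Real.log n.factorial - n * Real.log 2 + Real.log (Real.sqrt Real.pi)) / 2 ≤
      Real.log (Real.Gamma (n / 2 + 1)) ∧
    Real.log (Real.Gamma (n / 2 + 1)) ≤
      (Real.log n.factorial - n * Real.log 2 + Real.log (Real.sqrt Real.pi)) / 2 +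
        Real.log (((n : ℝ) + 1) / 2) / 2 := by
  have hn' : (3 : ℝ) ≤ n := by exact_mod_cast hn
  have ha : 0 < Real.Gamma ((n : ℝ) / 2 + 1) := Real.Gamma_pos_of_pos (by positivity)
  have hb : 0 < Real.Gamma (((n : ℝ) + 1) / 2) := Real.Gamma_pos_of_pos (by positivity)
  have hab : Real.Gamma (((n : ℝ) + 1) / 2) * Real.Gamma ((n : ℝ) / 2 + 1) =
      n.factorial * 2 ^ (-(n : ℝ)) * Real.sqrt Real.pi := by
    have := Real.Gamma_mul_Gamma_add_half (((n : ℝ) + 1) / 2)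
    rw [show ((n : ℝ) + 1) / 2 + 1 / 2 = n / 2 + 1 by ring,
      show 2 * (((n : ℝ) + 1) / 2) = n + 1 by ring, Real.Gamma_nat_eq_factorial,
      show 1 - ((n : ℝ) + 1) = -n by ring] at this
    exact this
  have hlog : Real.log (Real.Gamma (((n : ℝ) + 1) / 2)) + Real.log (Real.Gamma ((n : ℝ) / 2 + 1)) =
      Real.log n.factorial - n * Real.log 2 + Real.log (Real.sqrt Real.pi) := by
    rw [← Real.log_mul hb.ne' ha.ne', hab, Real.log_mul (by positivity) (by positivity),
      Real.log_mul (by positivity) (by positivity), Real.log_rpow (by norm_num)]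
    ring
  have h1 : Real.log (Real.Gamma (((n : ℝ) + 1) / 2)) ≤ Real.log (Real.Gamma ((n : ℝ) / 2 + 1)) :=
    Real.log_le_log hb (Real.Gamma_strictMonoOn_Ici.monotoneOn (by simp; linarith)
      (by simp; linarith) (by linarith))
  have h2 : Real.log (Real.Gamma ((n : ℝ) / 2 + 1)) ≤
      Real.log (((n : ℝ) + 1) / 2) + Real.log (Real.Gamma (((n : ℝ) + 1) / 2)) := by
    rw [← Real.log_mul (by positivity) hb.ne', ← Real.Gamma_add_one (by positivity)]
    exact Real.log_le_log ha (Real.Gamma_strictMonoOn_Ici.monotoneOn (by simp; linarith)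
      (by simp; linarith) (by linarith))
  constructor <;> linarith

lemma tendsto_log_natCast_div : Tendsto (fun n : ℕ => Real.log n / (n : ℝ)) atTop (𝓝 0) :=
  (Real.isLittleO_log_id_atTop.tendsto_div_nhds_zero).comp tendsto_natCast_atTop_atTop

lemma tendsto_log_ballVolume_div :
    Tendsto (fun n : ℕ => Real.log (ballVolume n) / n) atTop
      (𝓝 (1 / 2 * Real.log (2 * Real.pi * Real.exp 1))) := by
  -- The error left after dividing by `n` once Stirling's formula replaces `log n!`.
  let E : ℕ → ℝ := fun n =>
    (Real.log (Stirling.stirlingSeq n) / n + 1 / 2 * (Real.log 2 / n + Real.log n / n) +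
      Real.log (Real.sqrt Real.pi) / n) / 2
  have hE : Tendsto E atTop (𝓝 0) := by
    have h1 : Tendsto (fun n : ℕ => Real.log (Stirling.stirlingSeq n) / n) atTop (𝓝 0) :=
      ((Stirling.tendsto_stirlingSeq_sqrt_pi.log (by positivity))).div_atTop
        tendsto_natCast_atTop_atTop
    have h2 : ∀ c : ℝ, Tendsto (fun n : ℕ => c / n) atTop (𝓝 0) := fun c =>
      tendsto_const_nhds.div_atTop tendsto_natCast_atTop_atTop
    have := ((h1.add (((h2 (Real.log 2)).add tendsto_log_natCast_div).const_mul (1 / 2))).add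
      (h2 (Real.log (Real.sqrt Real.pi)))).div_const 2
    simpa [E] using this
  have hF : Tendsto (fun n : ℕ => E n + Real.log n / n) atTop (𝓝 0) := by
    simpa using hE.add tendsto_log_natCast_div
  set c := 1 / 2 * Real.log (2 * Real.pi * Real.exp 1) with hc
  have hc' : c = (Real.log 2 + Real.log Real.pi + 1) / 2 := by
    rw [hc, Real.log_mul (by positivity) (by positivity), Real.log_mul (by positivity)
      (by positivity), Real.log_exp]
    ring
  have hkey : ∀ n : ℕ, 3 ≤ n → c - (E n + Real.log n / n) ≤ Real.log (ballVolume n) / n ∧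
      Real.log (ballVolume n) / n ≤ c - E n := fun n hn => by
    have hn0 : (0 : ℝ) < n := by exact_mod_cast (by omega : 0 < n)
    have hn3 : (3 : ℝ) ≤ n := by exact_mod_cast hn
    have hG : 0 < Real.Gamma ((n : ℝ) / 2 + 1) := Real.Gamma_pos_of_pos (by positivity)
    have hlogV : Real.log (ballVolume n) =
        n * (Real.log n / 2) + n * (Real.log Real.pi / 2) - Real.log (Real.Gamma (n / 2 + 1)) := by
      rw [ballVolume, Real.log_mul (by positivity) (by positivity), Real.log_div (by positivity)
        hG.ne', Real.log_pow, Real.log_pow, Real.log_sqrt hn0.le, Real.log_sqrt Real.pi_pos.le]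
      ring
    have hst := Stirling.log_stirlingSeq_formula n
    rw [Real.log_div hn0.ne' (by positivity), Real.log_exp, Real.log_mul two_ne_zero hn0.ne'] at hst
    have hEn : n * E n = (Real.log (Stirling.stirlingSeq n) + 1 / 2 * (Real.log 2 + Real.log n) +
        Real.log (Real.sqrt Real.pi)) / 2 := by
      simp only [E]; field_simp
    have hln : Real.log (((n : ℝ) + 1) / 2) ≤ Real.log n :=
      Real.log_le_log (by positivity) (by linarith)
    have hln0 : 0 ≤ Real.log n := Real.log_nonneg (by linarith)
    obtain ⟨hl, hu⟩ := log_Gamma_half_bounds hn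
    rw [le_div_iff₀ hn0, div_le_iff₀ hn0, hlogV, hc']
    have e1 : Real.log n / n * n = Real.log n := div_mul_cancel₀ _ hn0.ne'
    constructor
    · nlinarith
    · nlinarith
  refine tendsto_of_tendsto_of_tendsto_of_le_of_le' (g := fun n => c - (E n + Real.log n / n))
    (h := fun n => c - E n) ?_ ?_ ?_ ?_
  · simpa using hF.const_sub c
  · simpa using hE.const_sub c
  · filter_upwards [eventually_ge_atTop 3] with n hn using (hkey n hn).1
  · filter_upwards [eventually_ge_atTop 3] with n hn using (hkey n hn).2

/-! ### The zeros of the rate function and `R*`. -/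

/-- A lower semicontinuous function attains its minimum on the compact set `F ∩ {I ≤ 1}`; outside
that level set `I` exceeds `1` anyway. -/
lemma IsGoodRateFunction.exists_pos_le {I : ℝ → ℝ≥0∞} (h : IsGoodRateFunction I) {F : Set ℝ}
    (hF : IsClosed F) (h0 : ∀ x ∈ F, I x ≠ 0) :
    ∃ δ : ℝ, 0 < δ ∧ ∀ x ∈ F, ENNReal.ofReal δ ≤ I x := by
  have hc : IsCompact (F ∩ {x | I x ≤ ((1 : ℝ≥0) : ℝ≥0∞)}) := (h.isCompact_level 1).inter_left hF
  rcases (F ∩ {x | I x ≤ ((1 : ℝ≥0) : ℝ≥0∞)}).eq_empty_or_nonempty with he | hne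
  · refine ⟨1, one_pos, fun x hx => ?_⟩
    by_contra hlt
    have : x ∈ F ∩ {x | I x ≤ ((1 : ℝ≥0) : ℝ≥0∞)} := ⟨hx, by simpa using (not_le.1 hlt).le⟩
    rw [he] at this
    exact this
  · obtain ⟨a, ha, hmin⟩ :=
      (h.lowerSemicontinuous.lowerSemicontinuousOn _).exists_isMinOn hne hc
    have ha1 : I a ≤ 1 := by simpa using ha.2
    have hat : I a ≠ ⊤ := (ha1.trans_lt ENNReal.one_lt_top).ne
    refine ⟨(I a).toReal, ENNReal.toReal_pos (h0 a ha.1) hat, fun x hx => ?_⟩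
    rw [ENNReal.ofReal_toReal hat]
    by_cases hx1 : I x ≤ 1
    · exact hmin ⟨hx, by simpa using hx1⟩
    · exact ha1.trans (not_le.1 hx1).le

lemma tendsto_zero_of_expGrowthSup_neg {u : ℕ → ℝ≥0∞} (h : ExpGrowth.expGrowthSup u < 0) :
    Tendsto u atTop (𝓝 0) := by
  obtain ⟨b, hb, hb0⟩ := EReal.lt_iff_exists_real_btwn.1 h
  have h1 := ExpGrowth.eventually_le_exp hb
  have h2 : Tendsto (fun n : ℕ => EReal.exp ((b : EReal) * n)) atTop (𝓝 0) := by
    simp_rw [mul_comm (b : EReal), EReal.exp_nmul]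
    exact ENNReal.tendsto_pow_atTop_nhds_zero_of_lt_one (by simpa using hb0)
  exact tendsto_of_tendsto_of_tendsto_of_le_of_le' tendsto_const_nhds h2
    (Eventually.of_forall fun _ => zero_le) h1

lemma SatisfiesLDP.expGrowthSup_le {μ : ℕ → Measure ℝ} {I : ℝ → ℝ≥0∞} (h : SatisfiesLDP μ I)
    {F : Set ℝ} (hF : IsClosed F) {a : EReal} (ha : ∀ x ∈ F, a ≤ I x) :
    ExpGrowth.expGrowthSup (fun n => μ n F) ≤ -a :=
  (h.upper F hF).trans (EReal.neg_le_neg_iff.2 (le_iInf₂ ha))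

lemma SatisfiesLDP.tendsto_zero {μ : ℕ → Measure ℝ} {I : ℝ → ℝ≥0∞} (h : SatisfiesLDP μ I)
    (hI : IsGoodRateFunction I) {F : Set ℝ} (hF : IsClosed F) (h0 : ∀ x ∈ F, I x ≠ 0) :
    Tendsto (fun n => μ n F) atTop (𝓝 0) := by
  obtain ⟨δ, hδ, hle⟩ := hI.exists_pos_le hF h0
  refine tendsto_zero_of_expGrowthSup_neg
    ((h.expGrowthSup_le hF (a := (δ : EReal)) fun x hx => ?_).trans_lt ?_)
  · have h1 : ((ENNReal.ofReal δ : ℝ≥0∞) : EReal) ≤ I x := by exact_mod_cast hle x hx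
    rwa [EReal.coe_ennreal_ofReal, max_eq_left hδ.le] at h1
  · exact_mod_cast (neg_neg_of_pos hδ)

lemma RadiusAssumptions.exists_zero {μ : ℕ → Measure ℝ} {I : ℝ → ℝ≥0∞} {Rstar : ℝ}
    (h : RadiusAssumptions μ I Rstar) : ∃ x, I x = 0 := by
  by_contra hne
  push Not at hne
  have h1 := h.ldp.tendsto_zero h.goodRate isClosed_univ fun x _ => hne x
  have h2 : Tendsto (fun n => μ n univ) atTop (𝓝 1) := by
    refine tendsto_const_nhds.congr' ?_
    filter_upwards [eventually_ge_atTop 1] with n hn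
    have := h.isProbabilityMeasure n hn
    exact measure_univ.symm
  exact zero_ne_one (tendsto_nhds_unique h1 h2)

lemma RadiusAssumptions.exists_moment_le {μ : ℕ → Measure ℝ} {I : ℝ → ℝ≥0∞} {Rstar : ℝ}
    (h : RadiusAssumptions μ I Rstar) : ∃ γ C : ℝ, 1 < γ ∧ 0 < C ∧ ∀ᶠ n : ℕ in atTop,
      ∫⁻ x, ENNReal.ofReal x ^ (γ * (n : ℝ)) ∂(μ n) ≤ ENNReal.ofReal C ^ n := by
  obtain ⟨γ, hγ, hlim⟩ := h.moment
  obtain ⟨C, hC, hCt⟩ := exists_between hlim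
  refine ⟨γ, C.toReal, hγ, ENNReal.toReal_pos (zero_le.trans_lt hC).ne' hCt.ne, ?_⟩
  filter_upwards [eventually_lt_of_limsup_lt hC, eventually_ge_atTop 1] with n hn hn1
  have hn0 : (0 : ℝ) < n := by exact_mod_cast hn1
  rw [ENNReal.ofReal_toReal hCt.ne, ← ENNReal.rpow_natCast,
    ← ENNReal.rpow_le_rpow_iff (one_div_pos.2 hn0), ← ENNReal.rpow_mul,
    mul_one_div_cancel hn0.ne', ENNReal.rpow_one]
  exact hn.le

/-- The contribution of large radii to the `n`-th moment is exponentially negligible. -/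
lemma RadiusAssumptions.exists_tail_le {μ : ℕ → Measure ℝ} {I : ℝ → ℝ≥0∞} {Rstar : ℝ}
    (h : RadiusAssumptions μ I Rstar) (L K₀ : ℝ) : ∃ K : ℝ, K₀ ≤ K ∧
      ExpGrowth.expGrowthSup (fun n => ∫⁻ x in Ici K, ENNReal.ofReal x ^ n ∂(μ n)) ≤ L := by
  -- For `x ≥ K`, `x ≤ K^{-(γ-1)} x^γ`, so the tail is at most `(K^{-(γ-1)} C)^n`; a large `K` makes
  -- the base at most `e^L`.
  obtain ⟨γ, C, hγ, hC, hmom⟩ := h.exists_moment_le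
  have hlim : Tendsto (fun K : ℝ => K ^ (-(γ - 1)) * C) atTop (𝓝 (0 * C)) :=
    (tendsto_rpow_neg_atTop (by linarith)).mul_const C
  rw [zero_mul] at hlim
  obtain ⟨K, hK, hK1, hKK⟩ := ((hlim.eventually_le_const (Real.exp_pos L)).and
    ((eventually_ge_atTop 1).and (eventually_ge_atTop K₀))).exists
  have hK0 : 0 < K := by linarith
  refine ⟨K, hKK, Eventually.expGrowthSup_le ?_⟩
  filter_upwards [hmom] with n hn
  calc ∫⁻ x in Ici K, ENNReal.ofReal x ^ n ∂(μ n)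
      ≤ ∫⁻ x in Ici K, ENNReal.ofReal (K ^ (-(γ - 1))) ^ n *
          ENNReal.ofReal x ^ (γ * (n : ℝ)) ∂(μ n) := by
        refine setLIntegral_mono' measurableSet_Ici fun x hx => ?_
        have hx0 : 0 < x := hK0.trans_le hx
        rw [← ENNReal.ofReal_pow hx0.le, ← ENNReal.ofReal_pow (by positivity),
          ENNReal.ofReal_rpow_of_pos hx0, ← ENNReal.ofReal_mul (by positivity)]
        refine ENNReal.ofReal_le_ofReal ?_
        rw [Real.rpow_mul hx0.le, Real.rpow_natCast, ← mul_pow]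
        refine pow_le_pow_left₀ hx0.le ?_ n
        calc x = x ^ (-(γ - 1)) * x ^ γ := by
              rw [← Real.rpow_add hx0, show -(γ - 1) + γ = 1 by ring, Real.rpow_one]
          _ ≤ K ^ (-(γ - 1)) * x ^ γ := by
              refine mul_le_mul_of_nonneg_right ?_ (by positivity)
              exact Real.rpow_le_rpow_of_nonpos hK0 hx (by linarith)
    _ ≤ ∫⁻ x, ENNReal.ofReal (K ^ (-(γ - 1))) ^ n *
          ENNReal.ofReal x ^ (γ * (n : ℝ)) ∂(μ n) := setLIntegral_le_lintegral _ _
    _ = ENNReal.ofReal (K ^ (-(γ - 1))) ^ n *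
          ∫⁻ x, ENNReal.ofReal x ^ (γ * (n : ℝ)) ∂(μ n) :=
        lintegral_const_mul _ (ENNReal.measurable_ofReal.pow_const _)
    _ ≤ ENNReal.ofReal (K ^ (-(γ - 1))) ^ n * ENNReal.ofReal C ^ n := by gcongr
    _ = ENNReal.ofReal (K ^ (-(γ - 1)) * C) ^ n := by
        rw [← mul_pow, ENNReal.ofReal_mul (by positivity)]
    _ ≤ ENNReal.ofReal (Real.exp L) ^ n := by gcongr
    _ = EReal.exp (L * n) := by rw [mul_comm, EReal.exp_nmul, EReal.exp_coe]

/-- The mass of `[b, ∞)` vanishes in the limit, and the mean is at most `b + K μ_n[b, ∞)` plus a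
negligible tail beyond `K`. -/
lemma RadiusAssumptions.le_of_zeros_lt {μ : ℕ → Measure ℝ} {I : ℝ → ℝ≥0∞} {Rstar b : ℝ}
    (h : RadiusAssumptions μ I Rstar) (hb : 0 ≤ b) (h0 : ∀ x, b ≤ x → I x ≠ 0) : Rstar ≤ b := by
  -- Any negative rate would do; `K ≥ 1` lets the `n`-th power dominate `x` on the tail.
  obtain ⟨K, hKb, hK⟩ := h.exists_tail_le (-1) (max b 1)
  have hK1 : 1 ≤ K := (le_max_right _ _).trans hKb
  have ht := tendsto_zero_of_expGrowthSup_neg (hK.trans_lt (by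
    rw [← EReal.coe_zero, EReal.coe_lt_coe_iff]; norm_num))
  have hF := h.ldp.tendsto_zero h.goodRate (isClosed_Ici (a := b)) h0
  have hlim : Tendsto (fun n => ENNReal.ofReal b + ENNReal.ofReal K * μ n (Ici b) +
      ∫⁻ x in Ici K, ENNReal.ofReal x ^ n ∂(μ n)) atTop (𝓝 (ENNReal.ofReal b)) := by
    have := ((tendsto_const_nhds (x := ENNReal.ofReal b)).add
      (ENNReal.Tendsto.const_mul hF (.inr (ENNReal.ofReal_ne_top (r := K))))).add ht
    simpa using this
  have hle : ENNReal.ofReal Rstar ≤ ENNReal.ofReal b := by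
    refine le_of_tendsto_of_tendsto h.tendsto_mean hlim ?_
    filter_upwards [eventually_ge_atTop 1] with n hn
    have := h.isProbabilityMeasure n hn
    calc ∫⁻ x, ENNReal.ofReal x ∂(μ n)
        ≤ ∫⁻ x, (ENNReal.ofReal b + (Ici b).indicator (fun _ => ENNReal.ofReal K) x +
            (Ici K).indicator (fun x => ENNReal.ofReal x ^ n) x) ∂(μ n) := by
          refine lintegral_mono fun x => ?_
          rcases le_total x b with hx | hx
          · exact (ENNReal.ofReal_le_ofReal hx).trans (le_self_add.trans le_self_add)
          rcases le_total x K with hx' | hx'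
          · rw [indicator_of_mem (show x ∈ Ici b from hx)]
            exact (ENNReal.ofReal_le_ofReal hx').trans (le_add_self.trans le_self_add)
          · rw [indicator_of_mem (show x ∈ Ici K from hx')]
            refine le_trans ?_ le_add_self
            exact le_self_pow₀ (by simpa using hK1.trans hx') (by omega)
      _ = _ := by
          rw [lintegral_add_right _ ((ENNReal.measurable_ofReal.pow_const n).indicator
              measurableSet_Ici),
            lintegral_add_right _ (measurable_const.indicator measurableSet_Ici),
            lintegral_indicator_const measurableSet_Ici, lintegral_indicator measurableSet_Ici]
          simp
  exact (ENNReal.ofReal_le_ofReal_iff hb).1 hle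

/-- Markov's inequality, as the mass of `(-∞, a]` tends to `0`. -/
lemma RadiusAssumptions.le_of_lt_zeros {μ : ℕ → Measure ℝ} {I : ℝ → ℝ≥0∞} {Rstar a : ℝ}
    (h : RadiusAssumptions μ I Rstar) (h0 : ∀ x, x ≤ a → I x ≠ 0) : a ≤ Rstar := by
  have hF := h.ldp.tendsto_zero h.goodRate (isClosed_Iic (a := a)) h0
  have hlim : Tendsto (fun n => ENNReal.ofReal a * (1 - μ n (Iic a))) atTop
      (𝓝 (ENNReal.ofReal a)) := by
    have := ENNReal.Tendsto.const_mul (ENNReal.Tendsto.sub (tendsto_const_nhds (x := (1 : ℝ≥0∞)))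
      hF (.inl ENNReal.one_ne_top)) (.inr (ENNReal.ofReal_ne_top (r := a)))
    simpa using this
  have hle : ENNReal.ofReal a ≤ ENNReal.ofReal Rstar := by
    refine le_of_tendsto_of_tendsto hlim h.tendsto_mean ?_
    filter_upwards [eventually_ge_atTop 1] with n hn
    have := h.isProbabilityMeasure n hn
    rw [← prob_compl_eq_one_sub measurableSet_Iic, compl_Iic, ← setLIntegral_const]
    refine (setLIntegral_mono' measurableSet_Ioi fun x hx => ?_).trans
      (setLIntegral_le_lintegral _ _)
    exact ENNReal.ofReal_le_ofReal (le_of_lt hx)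
  exact (ENNReal.ofReal_le_ofReal_iff h.Rstar_pos.le).1 hle

/-- The zero set of `I` is compact and nonempty. The limiting mean can lie neither above its
greatest element `b` nor below its least element `a`, and by convexity `I` vanishes on all of `[a,
b]`. -/
lemma RadiusAssumptions.rate_Rstar {μ : ℕ → Measure ℝ} {I : ℝ → ℝ≥0∞} {Rstar : ℝ}
    (h : RadiusAssumptions μ I Rstar) : I Rstar = 0 := by
  by_contra hne
  have hZ : {x | I x = 0} = {x | I x ≤ ((0 : ℝ≥0) : ℝ≥0∞)} := by ext; simp
  have hcomp : IsCompact {x | I x = 0} := hZ ▸ h.goodRate.isCompact_level 0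
  obtain ⟨z, hz⟩ := h.exists_zero
  have hneZ : {x | I x = 0}.Nonempty := ⟨z, hz⟩
  obtain ⟨a, ha, hal⟩ := hcomp.exists_isLeast hneZ
  obtain ⟨b, hb, hbu⟩ := hcomp.exists_isGreatest hneZ
  have hpos := h.Rstar_pos
  rcases lt_or_ge b Rstar with hbR | hbR
  -- A point strictly between the zeros and `R*`, kept nonnegative as the mean bound requires.
  · have := h.le_of_zeros_lt (b := (max b 0 + Rstar) / 2) (by positivity) fun x hx hx0 => by
      have h1 : x ≤ b := hbu hx0
      have h2 : max b 0 < Rstar := max_lt hbR hpos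
      have h3 := le_max_left b 0
      linarith
    have h2 : max b 0 < Rstar := max_lt hbR hpos
    linarith
  rcases lt_or_ge Rstar a with haR | haR
  · have := h.le_of_lt_zeros (a := (a + Rstar) / 2) fun x hx hx0 => by
      have h1 : a ≤ x := hal hx0
      linarith
    linarith
  · obtain ⟨p, q, hp, hq, hpq, hR⟩ : ∃ p q : ℝ, 0 ≤ p ∧ 0 ≤ q ∧ p + q = 1 ∧
        p • a + q • b = Rstar := by
      have : Rstar ∈ segment ℝ a b := Icc_subset_segment ⟨haR, hbR⟩
      exact this
    have hpq' : p.toNNReal + q.toNNReal = 1 := by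
      rw [← Real.toNNReal_add hp hq, hpq, Real.toNNReal_one]
    have := h.convex.2 (mem_univ a) (mem_univ b) (zero_le (a := p.toNNReal))
      (zero_le (a := q.toNNReal)) hpq'
    rw [show I a = 0 from ha, show I b = 0 from hb] at this
    simp only [NNReal.smul_def, Real.coe_toNNReal _ hp, Real.coe_toNNReal _ hq, hR, smul_zero,
      add_zero] at this
    exact hne (le_antisymm this zero_le)

/-! ### Exponential rate of the `n`-th moments. -/

/-- For `0 < R' < R`, the moment is at least `R'^n μ_n(R', ∞)`, and the open half-line contains `R`;
then `R'` increases to `R`. -/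
lemma RadiusAssumptions.log_sub_rate_le_expGrowthInf {μ : ℕ → Measure ℝ} {I : ℝ → ℝ≥0∞}
    {Rstar : ℝ} (h : RadiusAssumptions μ I Rstar) {R : ℝ} (hR : 0 < R) :
    (Real.log R : EReal) - I R ≤
      ExpGrowth.expGrowthInf (fun n => ∫⁻ x, ENNReal.ofReal x ^ n ∂(μ n)) := by
  have key : ∀ R' : ℝ, 0 < R' → R' < R → (Real.log R' : EReal) - I R ≤
      ExpGrowth.expGrowthInf (fun n => ∫⁻ x, ENNReal.ofReal x ^ n ∂(μ n)) := fun R' h0 hlt => by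
    have h1 : -(I R : EReal) ≤ ExpGrowth.expGrowthInf (fun n => μ n (Ioi R')) :=
      (EReal.neg_le_neg_iff.2 (iInf₂_le R hlt)).trans (h.ldp.lower _ isOpen_Ioi)
    have h2 : ExpGrowth.expGrowthInf (fun n => ENNReal.ofReal R' ^ n) = Real.log R' := by
      rw [ExpGrowth.expGrowthInf_pow, ENNReal.log_ofReal_of_pos h0]
    calc (Real.log R' : EReal) - I R ≤ ExpGrowth.expGrowthInf (fun n => ENNReal.ofReal R' ^ n) +
          ExpGrowth.expGrowthInf (fun n => μ n (Ioi R')) := by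
          rw [h2, sub_eq_add_neg]; gcongr
      _ ≤ ExpGrowth.expGrowthInf ((fun n => ENNReal.ofReal R' ^ n) * fun n => μ n (Ioi R')) :=
          ExpGrowth.le_expGrowthInf_mul
      _ ≤ _ := ExpGrowth.expGrowthInf_monotone fun n => by
          simp only [Pi.mul_apply]
          rw [← setLIntegral_const]
          refine (setLIntegral_mono' measurableSet_Ioi fun x hx => ?_).trans
            (setLIntegral_le_lintegral _ _)
          gcongr
          exact le_of_lt hx
  by_cases hI : I R = ⊤
  · simp [hI]
  lift I R to ℝ≥0 using hI with i
  have hlim : Tendsto (fun R' : ℝ => ((Real.log R' - i : ℝ) : EReal)) (𝓝[<] R)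
      (𝓝 ((Real.log R - i : ℝ) : EReal)) :=
    EReal.tendsto_coe.2 (((Real.continuousAt_log hR.ne').tendsto.mono_left
      nhdsWithin_le_nhds).sub_const _)
  refine le_of_tendsto hlim ?_
  filter_upwards [Ioo_mem_nhdsLT hR] with R' hR'
  exact key R' hR'.1 hR'.2

/-- On the slice `[R, R e^η]` the integrand has rate at most `log R + η` and the mass at most `-(j +
log R)`. The terms `log R` cancel, so every slice contributes at most `η - j`, wherever it lies. -/
lemma RadiusAssumptions.expGrowthSup_Ici_step {μ : ℕ → Measure ℝ} {I : ℝ → ℝ≥0∞}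
    {Rstar : ℝ} (h : RadiusAssumptions μ I Rstar) {j η R : ℝ}
    (hj : ∀ x ∈ Ici Rstar, ((j + Real.log x : ℝ) : EReal) ≤ I x) (hR : Rstar ≤ R) :
    ExpGrowth.expGrowthSup (fun n => ∫⁻ x in Ici R, ENNReal.ofReal x ^ n ∂(μ n)) ≤
      max ((η - j : ℝ) : EReal) (ExpGrowth.expGrowthSup
        (fun n => ∫⁻ x in Ici (R * Real.exp η), ENNReal.ofReal x ^ n ∂(μ n))) := by
  have hR0 : 0 < R := h.Rstar_pos.trans_le hR
  have h1 : ExpGrowth.expGrowthSup (fun n => μ n (Icc R (R * Real.exp η))) ≤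
      -((j + Real.log R : ℝ) : EReal) := by
    refine h.ldp.expGrowthSup_le isClosed_Icc fun x hx => ?_
    refine le_trans ?_ (hj x (hR.trans hx.1))
    rw [EReal.coe_le_coe_iff]
    have := Real.log_le_log hR0 hx.1
    linarith
  have h2 : ExpGrowth.expGrowthSup (fun n => ENNReal.ofReal (R * Real.exp η) ^ n) =
      ((Real.log R + η : ℝ) : EReal) := by
    rw [ExpGrowth.expGrowthSup_pow, ENNReal.log_ofReal_of_pos (by positivity),
      Real.log_mul hR0.ne' (by positivity), Real.log_exp]
  have h3 : ExpGrowth.expGrowthSup ((fun n => ENNReal.ofReal (R * Real.exp η) ^ n) *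
      fun n => μ n (Icc R (R * Real.exp η))) ≤ ((η - j : ℝ) : EReal) := by
    refine (ExpGrowth.expGrowthSup_mul_le (.inl (by rw [h2]; exact EReal.coe_ne_bot _))
      (.inl (by rw [h2]; exact EReal.coe_ne_top _))).trans ?_
    rw [h2]
    refine (add_le_add_right h1 _).trans (le_of_eq ?_)
    rw [← EReal.coe_neg, ← EReal.coe_add]
    congr 1; ring
  calc _ ≤ ExpGrowth.expGrowthSup (((fun n => ENNReal.ofReal (R * Real.exp η) ^ n) *
        fun n => μ n (Icc R (R * Real.exp η))) +
        fun n => ∫⁻ x in Ici (R * Real.exp η), ENNReal.ofReal x ^ n ∂(μ n)) := by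
        refine ExpGrowth.expGrowthSup_monotone fun n => ?_
        have hsub : Ici R ⊆ Icc R (R * Real.exp η) ∪ Ici (R * Real.exp η) := fun x hx => by
          rcases le_total x (R * Real.exp η) with h' | h'
          · exact .inl ⟨hx, h'⟩
          · exact .inr h'
        refine (lintegral_mono_set hsub).trans ((lintegral_union_le _ _ _).trans ?_)
        simp only [Pi.add_apply, Pi.mul_apply]
        gcongr
        rw [← setLIntegral_const]
        refine setLIntegral_mono' measurableSet_Icc fun x hx => ?_
        gcongr
        exact hx.2
    _ ≤ _ := by
        rw [ExpGrowth.expGrowthSup_add]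
        exact sup_le_sup_right h3 _

lemma RadiusAssumptions.expGrowthSup_moment_le_max {μ : ℕ → Measure ℝ} {I : ℝ → ℝ≥0∞}
    {Rstar R : ℝ} (h : RadiusAssumptions μ I Rstar) (hR : 0 < R) :
    ExpGrowth.expGrowthSup (fun n => ∫⁻ x, ENNReal.ofReal x ^ n ∂(μ n)) ≤
      max (Real.log R : EReal)
        (ExpGrowth.expGrowthSup (fun n => ∫⁻ x in Ici R, ENNReal.ofReal x ^ n ∂(μ n))) := by
  rw [← ENNReal.log_ofReal_of_pos hR, ← ExpGrowth.expGrowthSup_pow]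
  refine le_trans (ExpGrowth.expGrowthSup_eventually_monotone ?_) ExpGrowth.expGrowthSup_add.le
  filter_upwards [eventually_ge_atTop 1] with n hn
  have := h.isProbabilityMeasure n hn
  rw [← setLIntegral_univ, ← Iic_union_Ici (a := R)]
  refine (lintegral_union_le _ _ _).trans ?_
  simp only [Pi.add_apply]
  gcongr
  calc ∫⁻ x in Iic R, ENNReal.ofReal x ^ n ∂(μ n)
      ≤ ∫⁻ x in Iic R, ENNReal.ofReal R ^ n ∂(μ n) := by
        refine setLIntegral_mono' measurableSet_Iic fun x hx => ?_
        gcongr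
        exact hx
    _ ≤ ENNReal.ofReal R ^ n := by
        rw [setLIntegral_const]
        exact mul_le_of_le_one_right' prob_le_one

/-- The infimum in the formula for the threshold is a real number, and it is the exponential rate of
the `n`-th moments of the radii. -/
lemma RadiusAssumptions.exists_moment_rate {μ : ℕ → Measure ℝ} {I : ℝ → ℝ≥0∞}
    {Rstar : ℝ} (h : RadiusAssumptions μ I Rstar) :
    ∃ j : ℝ, (⨅ R ∈ Ici Rstar, ((I R : EReal) - (Real.log R : EReal))) = j ∧
      Tendsto (fun n : ℕ => ENNReal.log (∫⁻ x, ENNReal.ofReal x ^ n ∂(μ n)) / (n : EReal)) atTop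
        (𝓝 ((-j : ℝ) : EReal)) := by
  set M : ℕ → ℝ≥0∞ := fun n => ∫⁻ x, ENNReal.ofReal x ^ n ∂(μ n) with hM
  have hpos := h.Rstar_pos
  have hneg : ∀ R : ℝ, (I R : EReal) - (Real.log R : EReal) = -((Real.log R : EReal) - I R) :=
    fun R => by
      rw [EReal.neg_sub (.inl (EReal.coe_ne_bot _)) (.inl (EReal.coe_ne_top _)), add_comm,
        sub_eq_add_neg]
  set J := ⨅ R ∈ Ici Rstar, ((I R : EReal) - (Real.log R : EReal)) with hJ
  have hlow : -ExpGrowth.expGrowthInf M ≤ J := le_iInf₂ fun R hR => by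
    rw [hneg, EReal.neg_le_neg_iff]
    exact h.log_sub_rate_le_expGrowthInf (hpos.trans_le hR)
  have hJup : J ≤ ((-Real.log Rstar : ℝ) : EReal) := by
    refine (iInf₂_le Rstar self_mem_Ici).trans ?_
    simp [h.rate_Rstar]
  obtain ⟨K, hKR, hK⟩ := h.exists_tail_le 0 Rstar
  have hsup : ExpGrowth.expGrowthSup M < ⊤ :=
    (h.expGrowthSup_moment_le_max (hpos.trans_le hKR)).trans_lt
      (max_lt (EReal.coe_lt_top _) (hK.trans_lt (EReal.coe_lt_top _)))
  -- The lower bound on the moments gives `-J` at most their growth rate, which is finite by the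
  -- tail estimate.
  have hJbot : J ≠ ⊥ := fun hb => by
    rw [hb, le_bot_iff, EReal.neg_eq_bot_iff] at hlow
    exact (hlow ▸ (ExpGrowth.expGrowthInf_le_expGrowthSup (u := M))).not_gt hsup
  have hJtop : J ≠ ⊤ := (hJup.trans_lt (EReal.coe_lt_top _)).ne
  obtain ⟨j, hj⟩ : ∃ j : ℝ, J = j := ⟨J.toReal, (EReal.coe_toReal hJtop hJbot).symm⟩
  refine ⟨j, hj, ?_⟩
  have hjle : ∀ x ∈ Ici Rstar, ((j + Real.log x : ℝ) : EReal) ≤ I x := fun x hx => by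
    have h1 : (j : EReal) ≤ (I x : EReal) - (Real.log x : EReal) := hj ▸ iInf₂_le x hx
    rw [EReal.coe_add]
    exact EReal.add_le_of_le_sub h1
  have hup : ExpGrowth.expGrowthSup M ≤ ((-j : ℝ) : EReal) := by
    have hη : ∀ η : ℝ, 0 < η → ExpGrowth.expGrowthSup M ≤ ((η - j : ℝ) : EReal) := fun η hη => by
      obtain ⟨K, hKR, hK⟩ := h.exists_tail_le (η - j) Rstar
      -- Finitely many slices of ratio `e^η` lead from `R*` past `K`; a maximum of finitely many
      -- rates does not accumulate error.
      have hstep : ∀ N : ℕ, ExpGrowth.expGrowthSup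
          (fun n => ∫⁻ x in Ici Rstar, ENNReal.ofReal x ^ n ∂(μ n)) ≤
          max ((η - j : ℝ) : EReal) (ExpGrowth.expGrowthSup
            (fun n => ∫⁻ x in Ici (Rstar * Real.exp η ^ N), ENNReal.ofReal x ^ n ∂(μ n))) := by
        intro N
        induction N with
        | zero => simp
        | succ N ih =>
          refine ih.trans (max_le (le_max_left _ _) ?_)
          have := h.expGrowthSup_Ici_step (η := η) hjle (R := Rstar * Real.exp η ^ N)
            (le_mul_of_one_le_right hpos.le (one_le_pow₀ (Real.one_le_exp hη.le)))
          rwa [mul_assoc, ← pow_succ] at this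
      obtain ⟨N, hN⟩ := pow_unbounded_of_one_lt (K / Rstar) (Real.one_lt_exp_iff.2 hη)
      have hKN : K ≤ Rstar * Real.exp η ^ N := by
        rw [div_lt_iff₀ hpos] at hN
        linarith
      refine (h.expGrowthSup_moment_le_max hpos).trans (max_le ?_ ((hstep N).trans (max_le le_rfl
        (le_trans (ExpGrowth.expGrowthSup_monotone fun n => ?_) hK))))
      -- Radii below `R*` contribute `log R*`, and `log R* ≤ -j` because `I(R*) = 0`.
      · rw [hj, EReal.coe_le_coe_iff] at hJup
        rw [EReal.coe_le_coe_iff]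
        linarith
      · exact lintegral_mono_set (Ici_subset_Ici.2 hKN)
    have hlim : Tendsto (fun η : ℝ => ((η - j : ℝ) : EReal)) (𝓝[>] 0)
        (𝓝 ((0 - j : ℝ) : EReal)) :=
      EReal.tendsto_coe.2 ((tendsto_id.mono_left nhdsWithin_le_nhds).sub_const j)
    rw [zero_sub] at hlim
    exact ge_of_tendsto hlim (eventually_nhdsWithin_of_forall fun η hη' => hη η hη')
  have hlow' : ((-j : ℝ) : EReal) ≤ ExpGrowth.expGrowthInf M := by
    rw [hj] at hlow
    rw [EReal.coe_neg]
    exact EReal.neg_le_of_neg_le hlow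
  exact tendsto_of_le_liminf_of_limsup_le hlow' hup

/-! ### From the mean number of covering balls to the volume fraction. -/

lemma one_sub_expNeg_le (x : ℝ≥0∞) : 1 - expNeg x ≤ x := by
  by_cases hx : x = ⊤
  · simp [hx]
  obtain ⟨y, hy, rfl⟩ : ∃ y : ℝ, 0 ≤ y ∧ x = ENNReal.ofReal y :=
    ⟨x.toReal, ENNReal.toReal_nonneg, (ENNReal.ofReal_toReal hx).symm⟩
  rw [expNeg_ofReal hy, ← ENNReal.ofReal_one, ← ENNReal.ofReal_sub _ (Real.exp_pos _).le]
  refine ENNReal.ofReal_le_ofReal ?_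
  have := Real.add_one_le_exp (-y)
  linarith

lemma half_mul_le_one_sub_expNeg {x : ℝ≥0∞} (hx : x ≤ 1) :
    ENNReal.ofReal (1 / 2) * x ≤ 1 - expNeg x := by
  have hxt : x ≠ ⊤ := (hx.trans_lt ENNReal.one_lt_top).ne
  obtain ⟨y, hy, rfl⟩ : ∃ y : ℝ, 0 ≤ y ∧ x = ENNReal.ofReal y :=
    ⟨x.toReal, ENNReal.toReal_nonneg, (ENNReal.ofReal_toReal hxt).symm⟩
  have hy1 : y ≤ 1 := by simpa using hx
  rw [expNeg_ofReal hy, ← ENNReal.ofReal_one, ← ENNReal.ofReal_sub _ (Real.exp_pos _).le,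
    ← ENNReal.ofReal_mul (by norm_num)]
  refine ENNReal.ofReal_le_ofReal ?_
  have h1 := Real.add_one_le_exp y
  have h2 : Real.exp (-y) ≤ 1 / (1 + y) := by
    rw [Real.exp_neg, ← one_div]
    exact one_div_le_one_div_of_le (by linarith) (by linarith)
  have h3 : 1 / (1 + y) ≤ 1 - 1 / 2 * y := by
    rw [div_le_iff₀ (by linarith)]
    nlinarith
  linarith

/-- A negative rate forces `L n → 0`, where `x/2 ≤ 1 - e^{-x} ≤ x`; the factor `1/2` does not affect
the rate. -/
lemma tendsto_log_one_sub_expNeg_div {L : ℕ → ℝ≥0∞} {r : EReal} (hr : r < 0)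
    (hL : Tendsto (fun n : ℕ => ENNReal.log (L n) / (n : EReal)) atTop (𝓝 r)) :
    Tendsto (fun n : ℕ => ENNReal.log (1 - expNeg (L n)) / (n : EReal)) atTop (𝓝 r) := by
  have hsup : ExpGrowth.expGrowthSup L = r := hL.limsup_eq
  have hinf : ExpGrowth.expGrowthInf L = r := hL.liminf_eq
  refine tendsto_of_le_liminf_of_limsup_le (?_ : r ≤ ExpGrowth.expGrowthInf _)
    (?_ : ExpGrowth.expGrowthSup _ ≤ r)
  · rw [← hinf]
    refine ExpGrowth.expGrowthInf_of_eventually_ge (b := ENNReal.ofReal (1 / 2)) (by simp) ?_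
    filter_upwards [(tendsto_zero_of_expGrowthSup_neg (hsup ▸ hr)).eventually_le_const
      zero_lt_one] with n hn
    exact half_mul_le_one_sub_expNeg hn
  · rw [← hsup]
    exact ExpGrowth.expGrowthSup_monotone fun n => one_sub_expNeg_le _

lemma tendsto_top_of_expGrowthInf_pos {u : ℕ → ℝ≥0∞} (h : 0 < ExpGrowth.expGrowthInf u) :
    Tendsto u atTop (𝓝 ⊤) := by
  obtain ⟨b, hb0, hb⟩ := EReal.lt_iff_exists_real_btwn.1 h
  have h1 := ExpGrowth.eventually_exp_le hb
  have h2 : Tendsto (fun n : ℕ => EReal.exp ((b : EReal) * n)) atTop (𝓝 ⊤) := by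
    simp_rw [mul_comm (b : EReal), EReal.exp_nmul]
    exact ENNReal.tendsto_pow_atTop_nhds_top_iff.2 (by simpa using hb0)
  exact tendsto_of_tendsto_of_tendsto_of_le_of_le' h2 tendsto_const_nhds h1
    (Eventually.of_forall fun _ => le_top)

/-- The mean number of balls covering the origin. -/
noncomputable def meanCover (μ : ℕ → Measure ℝ) (ρs : ℕ → ℝ) (n : ℕ) : ℝ≥0∞ :=
  (Real.toNNReal (Real.exp ((n : ℝ) * ρs n)) : ℝ≥0) * ∫⁻ x, volume (Metric.closedBall
    (0 : EuclideanSpace ℝ (Fin n)) (x * Real.sqrt n)) ∂(μ n)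

lemma log_meanCover_div {n : ℕ} (hn : 1 ≤ n) (μ : ℕ → Measure ℝ) (ρs : ℕ → ℝ) :
    ENNReal.log (meanCover μ ρs n) / (n : EReal) =
      ((ρs n + Real.log (ballVolume n) / n : ℝ) : EReal) +
        ENNReal.log (∫⁻ x, ENNReal.ofReal x ^ n ∂(μ n)) / (n : EReal) := by
  have hn0 : (n : ℝ) ≠ 0 := by positivity
  simp_rw [meanCover, volume_closedBall_mul_sqrt hn]
  rw [lintegral_const_mul _ (ENNReal.measurable_ofReal.pow_const n), ← mul_assoc,
    ENNReal.log_mul_add, EReal.add_div_of_nonneg_right (Nat.cast_nonneg' n)]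
  congr 1
  change ENNReal.log (ENNReal.ofReal _ * _) / _ = _
  rw [← ENNReal.ofReal_mul (Real.exp_pos _).le,
    ENNReal.log_ofReal_of_pos (mul_pos (Real.exp_pos _) (ballVolume_pos hn)),
    Real.log_mul (Real.exp_pos _).ne' (ballVolume_pos hn).ne', Real.log_exp]
  have : ((n : EReal)) = ((n : ℝ) : EReal) := rfl
  rw [this, ← EReal.coe_div]
  congr 1
  field_simp

lemma tendsto_log_meanCover_div {μ : ℕ → Measure ℝ} {ρs : ℕ → ℝ} {ρ m : ℝ}
    (hρ : Tendsto ρs atTop (𝓝 ρ))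
    (hM : Tendsto (fun n : ℕ => ENNReal.log (∫⁻ x, ENNReal.ofReal x ^ n ∂(μ n)) / (n : EReal))
      atTop (𝓝 (m : EReal))) :
    Tendsto (fun n => ENNReal.log (meanCover μ ρs n) / (n : EReal)) atTop
      (𝓝 ((ρ + 1 / 2 * Real.log (2 * Real.pi * Real.exp 1) + m : ℝ) : EReal)) := by
  have h1 := EReal.tendsto_coe.2 (hρ.add tendsto_log_ballVolume_div)
  have h2 := (EReal.continuousAt_add (p := (((ρ + 1 / 2 * Real.log (2 * Real.pi * Real.exp 1) : ℝ) :
    EReal), (m : EReal))) (.inl (EReal.coe_ne_top _)) (.inl (EReal.coe_ne_bot _))).tendsto.comp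
    (h1.prodMk_nhds hM)
  rw [EReal.coe_add]
  refine h2.congr' ?_
  filter_upwards [eventually_ge_atTop 1] with n hn
  exact (log_meanCover_div hn μ ρs).symm

section Regime

variable {Ω : Type*} [MeasurableSpace Ω] {P : Measure Ω} [IsProbabilityMeasure P]
  {μ : ℕ → Measure ℝ} {ρ m : ℝ} {ρs : ℕ → ℝ} {T : (n : ℕ) → ℕ → Ω → EuclideanSpace ℝ (Fin n)}
  {X : ℕ → ℕ → Ω → ℝ}

lemma IsShannonRegime.uncoverProb_eventuallyEq (h : IsShannonRegime P μ ρ ρs T X) :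
    (fun n => uncoverProb P (T n) (X n)) =ᶠ[atTop] fun n => expNeg (meanCover μ ρs n) := by
  filter_upwards [eventually_ge_atTop 1] with n hn using (h.marked n hn).uncoverProb_eq

lemma IsShannonRegime.coverProb_eventuallyEq (h : IsShannonRegime P μ ρ ρs T X) :
    (fun n => coverProb P (T n) (X n)) =ᶠ[atTop] fun n => 1 - expNeg (meanCover μ ρs n) := by
  filter_upwards [eventually_ge_atTop 1] with n hn
  rw [(h.marked n hn).coverProb_eq, (h.marked n hn).uncoverProb_eq]
  rfl

lemma IsShannonRegime.subcritical {r : ℝ} (h : IsShannonRegime P μ ρ ρs T X)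
    (hL : Tendsto (fun n => ENNReal.log (meanCover μ ρs n) / (n : EReal)) atTop (𝓝 (r : EReal)))
    (hr : r < 0) :
    Tendsto (fun n => coverProb P (T n) (X n)) atTop (𝓝 0) ∧
    Tendsto (fun n : ℕ => ENNReal.log (coverProb P (T n) (X n)) / (n : EReal)) atTop
      (𝓝 (r : EReal)) := by
  have hr' : (r : EReal) < 0 := by exact_mod_cast hr
  have hsup : ExpGrowth.expGrowthSup (meanCover μ ρs) = r := hL.limsup_eq
  constructor
  · refine Tendsto.congr' h.coverProb_eventuallyEq.symm ?_
    exact tendsto_of_tendsto_of_tendsto_of_le_of_le tendsto_const_nhds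
      (tendsto_zero_of_expGrowthSup_neg (hsup ▸ hr')) (fun _ => zero_le)
      fun n => one_sub_expNeg_le _
  · refine (tendsto_log_one_sub_expNeg_div hr' hL).congr' ?_
    filter_upwards [h.coverProb_eventuallyEq] with n hn
    rw [hn]

lemma IsShannonRegime.supercritical {r : ℝ} (h : IsShannonRegime P μ ρ ρs T X)
    (hL : Tendsto (fun n => ENNReal.log (meanCover μ ρs n) / (n : EReal)) atTop (𝓝 (r : EReal)))
    (hr : 0 < r) :
    Tendsto (fun n => coverProb P (T n) (X n)) atTop (𝓝 1) ∧
    Tendsto (fun n : ℕ =>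
      ENNReal.log (-ENNReal.log (uncoverProb P (T n) (X n))).toENNReal / (n : EReal)) atTop
      (𝓝 (r : EReal)) := by
  have hr' : (0 : EReal) < r := by exact_mod_cast hr
  have hinf : ExpGrowth.expGrowthInf (meanCover μ ρs) = r := hL.liminf_eq
  constructor
  · refine Tendsto.congr' h.coverProb_eventuallyEq.symm ?_
    have h1 := (continuous_expNeg.tendsto ⊤).comp (tendsto_top_of_expGrowthInf_pos (hinf ▸ hr'))
    have h2 := ENNReal.Tendsto.sub (tendsto_const_nhds (x := (1 : ℝ≥0∞))) h1
      (.inl ENNReal.one_ne_top)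
    simpa using h2
  · refine hL.congr' ?_
    filter_upwards [h.uncoverProb_eventuallyEq] with n hn
    -- The double logarithm undoes the exponential exactly, so no estimate is needed.
    rw [hn, log_expNeg, neg_neg, EReal.toENNReal_coe]

end Regime

/-! ### Uniqueness of the threshold and the theorem. -/

/-- Midway between two distinct thresholds the volume fraction would tend to both `0` and `1`. -/
lemma IsVolumeFractionThreshold.unique {p : ℝ → ℕ → ℝ≥0∞} {τ τ' : ℝ}
    (h : IsVolumeFractionThreshold p τ) (h' : IsVolumeFractionThreshold p τ') : τ = τ' := by
  have key : ∀ a b : ℝ, IsVolumeFractionThreshold p a → IsVolumeFractionThreshold p b → a ≤ b := by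
    intro a b ha hb
    by_contra! hlt
    exact zero_ne_one (tendsto_nhds_unique ((ha ((a + b) / 2)).1 (by linarith))
      ((hb ((a + b) / 2)).2 (by linarith)))
  exact le_antisymm (key _ _ h h') (key _ _ h' h)

theorem theorem1 (μ : ℕ → Measure ℝ) (I : ℝ → ℝ≥0∞) (Rstar : ℝ)
    (hμ : RadiusAssumptions μ I Rstar) :
    ∃ τ : ℝ,
      -- the formula for the threshold
      (τ : EReal) = ((-(1 / 2) * Real.log (2 * Real.pi * Real.exp 1) : ℝ) : EReal) +
        (⨅ R ∈ Ici Rstar, ((I R : EReal) - (Real.log R : EReal))) ∧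
      -- the volume fraction threshold exists, is unique, and equals it
      (∀ (Ω : Type*) [MeasurableSpace Ω] (P : Measure Ω) [IsProbabilityMeasure P]
        (ρs : ℝ → ℕ → ℝ) (T : ℝ → (n : ℕ) → ℕ → Ω → EuclideanSpace ℝ (Fin n))
        (X : ℝ → ℕ → ℕ → Ω → ℝ),
        (∀ ρ, IsShannonRegime P μ ρ (ρs ρ) (T ρ) (X ρ)) →
        ∀ τ' : ℝ,
          IsVolumeFractionThreshold (fun ρ n => coverProb P (T ρ n) (X ρ n)) τ' ↔ τ' = τ) ∧
      -- the asymptotics below and above the threshold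
      (∀ (Ω : Type*) [MeasurableSpace Ω] (P : Measure Ω) [IsProbabilityMeasure P]
        (ρ : ℝ) (ρs : ℕ → ℝ) (T : (n : ℕ) → ℕ → Ω → EuclideanSpace ℝ (Fin n))
        (X : ℕ → ℕ → Ω → ℝ),
        IsShannonRegime P μ ρ ρs T X →
        (ρ < τ →
          Tendsto (fun n => coverProb P (T n) (X n)) atTop (𝓝 0) ∧
          Tendsto (fun n : ℕ => ENNReal.log (coverProb P (T n) (X n)) / (n : EReal)) atTop
            (𝓝 ((ρ - τ : ℝ) : EReal))) ∧
        (τ < ρ →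
          Tendsto (fun n => coverProb P (T n) (X n)) atTop (𝓝 1) ∧
          Tendsto (fun n : ℕ =>
            ENNReal.log (-ENNReal.log (uncoverProb P (T n) (X n))).toENNReal / (n : EReal)) atTop
            (𝓝 ((ρ - τ : ℝ) : EReal)))) := by
  obtain ⟨j, hj, hM⟩ := hμ.exists_moment_rate
  have hrate : ∀ (ρ : ℝ) (ρs : ℕ → ℝ), Tendsto ρs atTop (𝓝 ρ) →
      Tendsto (fun n => ENNReal.log (meanCover μ ρs n) / (n : EReal)) atTop
        (𝓝 ((ρ - (-(1 / 2) * Real.log (2 * Real.pi * Real.exp 1) + j) : ℝ) : EReal)) :=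
    fun ρ ρs hρ => by
      convert tendsto_log_meanCover_div hρ hM using 3
      ring
  refine ⟨-(1 / 2) * Real.log (2 * Real.pi * Real.exp 1) + j, ?_, ?_, ?_⟩
  · rw [hj, EReal.coe_add]
  · intro Ω _ P _ ρs T X h τ'
    have hτ : IsVolumeFractionThreshold (fun ρ n => coverProb P (T ρ n) (X ρ n))
        (-(1 / 2) * Real.log (2 * Real.pi * Real.exp 1) + j) := fun ρ =>
      ⟨fun hlt => ((h ρ).subcritical (hrate ρ _ (h ρ).tendsto_rho) (by linarith)).1,
        fun hlt => ((h ρ).supercritical (hrate ρ _ (h ρ).tendsto_rho) (by linarith)).1⟩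
    exact ⟨fun h' => h'.unique hτ, fun h' => h' ▸ hτ⟩
  · intro Ω _ P _ ρ ρs T X h
    exact ⟨fun hlt => h.subcritical (hrate ρ ρs h.tendsto_rho) (by linarith),
      fun hlt => h.supercritical (hrate ρ ρs h.tendsto_rho) (by linarith)⟩
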